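/- **Model.** Let $E\subset\mathbb R$ be a finite set with $0\in E$. Let $Q(i,j,t)$ ($i,j\in E$, $t\ge 0$) be a semi-Markov kernel on $E$: for each $i$, $Q(i,\cdot,\cdot)$ describes a joint law of the next state $j\in E$ and of the sojourn time $\tau\ge 0$ in $i$, via $Q(i,j,t)=\mathbb P_i\{\text{next state}=j,\ \tau\le t\}$. Assume: (a) $p_{ij}=\lim_{t\to\infty}Q(i,j,t)>0$ for all $i,j\in E$; (b) the mean sojourn time in every state is finite; (c) there are $\alpha\in(1,2)$ and a locally bounded function $L:[0,\infty)\to[0,\infty)$, slowly varying at infinity, such that, as $t\to\infty$, $\mathbb P_0\{\tau\ge t\}\sim t^{-\alpha}L(t)$ and $\mathbb P_i\{\tau\ge t\}/(t^{-(\alpha+1)}L(t))\to 0$ for $i\in E\setminus\{0\}$; (d) in every state the law of the sojourn time has a continuous bounded density on $[0,\infty)$. Let $x^a=(x^a_t)_{t\ge0}$, $a=1,2,\dots$, be independent, identically distributed, stationary semi-Markov processes with kernel $Q$ on a probability space $(\Omega,\mathcal F,\mathbb P^*)$. That is, $x^a_t=\sum_{n\ge0}\xi^a_n\mathbf 1_{[T^a_n,T^a_{n+1})}(t)$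 with $\xi^a_n\in E$, $0=T^a_0\le T^a_1\le\cdots$, and, for $n\ge1$, $j\in E$, $t\ge 0$, $$\mathbb P^*\{\xi^a_{n+1}=j,\ T^a_{n+1}-T^a_n\le t\mid \xi^a_0,\dots,\xi^a_n;\,T^a_0,\dots,T^a_n\}=Q(\xi^a_n,j,t),$$ the joint law of $(\xi^a_0,T^a_1,\xi^a_1)$ being such that $x^a$ is stationary. Let $\nu$ be the stationary distribution, i.e. the law of $x^a_t$ (which depends neither on $t$ nor on $a$). Let $\lambda_\pm:E\times\mathbb R\to[0,\infty)$ be bounded functions such that for each $x\in E$ the function $\lambda_\pm(x,\cdot)$ is continuously differentiable with derivative bounded uniformly in $x$. Put $$\bar\lambda(s)=\int_E\lambda_+(x,s)\,\nu(dx)-\int_E\lambda_-(x,s)\,\nu(dx).$$ Let $\Pi_+,\Pi_-$ be independent standard Poisson processes on $(\Omega,\mathcal F,\mathbb P^*)$. For $N\ge1$ let the logarithmic price process $S^N$ be given by $$S^N_t=\frac1N\,\Pi_+\Big(\sum_{a=1}^N\int_0^t\lambda_+(x^a_u,S^N_u)\,du\Big)-\frac1N\,\Pi_-\Big(\sum_{a=1}^N\int_0^t\lambda_-(x^a_u,S^N_u)\,du\Big),\qquad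 t\ge0.$$ **Theorem.** The ODE $\frac{d}{dt}s_t=\bar\lambda(s_t)$, $s_0=0$, has a unique solution $(s_t)_{t\ge0}$, and $\mathbb P^*$-almost surely $$\lim_{N\to\infty}\ \sup_{0\le t\le t_0}|S^N_t-s_t|=0\qquad\text{for every }t_0\ge0.$$ -/

import Mathlib

open MeasureTheory ProbabilityTheory Filter Set
open scoped NNReal ENNReal Topology

noncomputable section

/-- A semi-Markov kernel on the finite state space `E ⊆ ℝ`: for each state `i ∈ E`, the joint law
`law i` on (next state) × (sojourn time in `i`).  In the usual notation
`Q(i, j, t) = law i ({j} × (-∞, t])`. -/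
structure SemiMarkovKernel (E : Finset ℝ) where
  law : ℝ → Measure (ℝ × ℝ)
  isProbabilityMeasure : ∀ i ∈ E, IsProbabilityMeasure (law i)
  support : ∀ i ∈ E, ∀ᵐ y ∂(law i), y.1 ∈ E ∧ 0 ≤ y.2

namespace SemiMarkovKernel

variable {E : Finset ℝ}

/-- `Q(i, j, t)`: the probability that, being in state `i`, the next state is `j` and the sojourn
time in `i` is at most `t`. -/
def Q (K : SemiMarkovKernel E) (i j t : ℝ) : ℝ := (K.law i).real ({j} ×ˢ Iic t)

/-- The transition probability `p i j` of the embedded Markov chain. -/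
def p (K : SemiMarkovKernel E) (i j : ℝ) : ℝ := (K.law i).real ({j} ×ˢ univ)

/-- The probability that the sojourn time in state `i` is at least `t`. -/
def tail (K : SemiMarkovKernel E) (i t : ℝ) : ℝ := (K.law i).real {y | t ≤ y.2}

/-- The standing assumptions on the semi-Markov kernel of an inert investor: positive transition
probabilities, finite mean sojourn times, regularly varying sojourn time tail of index
`α ∈ (1, 2)` in the inactive state `0`, lighter sojourn time tails in all the other states, and
continuous bounded sojourn time densities on `[0, ∞)`. -/
structure IsInert (K : SemiMarkovKernel E) : Prop where
  p_pos : ∀ i ∈ E, ∀ j ∈ E, 0 < K.p i j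
  finite_mean : ∀ i ∈ E, Integrable (fun y : ℝ × ℝ => y.2) (K.law i)
  tails : ∃ α : ℝ, 1 < α ∧ α < 2 ∧ ∃ L : ℝ → ℝ,
    (∀ t, 0 ≤ t → 0 ≤ L t) ∧
    (∀ b : ℝ, ∃ C : ℝ, ∀ t ∈ Icc 0 b, L t ≤ C) ∧
    (∀ c : ℝ, 0 < c → Tendsto (fun t => L (c * t) / L t) atTop (𝓝 1)) ∧
    Tendsto (fun t => K.tail 0 t / (t ^ (-α) * L t)) atTop (𝓝 1) ∧
    ∀ i ∈ E, i ≠ 0 → Tendsto (fun t => K.tail i t / (t ^ (-(α + 1)) * L t)) atTop (𝓝 0)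
  density : ∀ i ∈ E, ∃ f : ℝ → ℝ, ContinuousOn f (Ici 0) ∧
    (∃ C : ℝ, ∀ t, 0 ≤ t → 0 ≤ f t ∧ f t ≤ C) ∧
    (K.law i).map Prod.snd
      = (volume.restrict (Ici (0 : ℝ))).withDensity (fun t => ENNReal.ofReal (f t))

end SemiMarkovKernel

/-- The path `t ↦ ∑ n, ξ n * 1_{[T n, T (n+1))}(t)` with successive states `ξ n` and jump times
`T n`. Only times `t ≥ 0` matter. -/
def moodProcess {Ω : Type*} (ξ T : ℕ → Ω → ℝ) (t : ℝ) (ω : Ω) : ℝ :=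
  ∑' n : ℕ, (Ico (T n ω) (T (n + 1) ω)).indicator (fun _ => ξ n ω) t

/-- The σ-algebra generated by `ξ 0, …, ξ n` and `T 0, …, T n`. -/
@[reducible]
def renewalHistory {Ω : Type*} (ξ T : ℕ → Ω → ℝ) (n : ℕ) : MeasurableSpace Ω :=
  MeasurableSpace.comap (fun ω (k : Fin (n + 1)) => (ξ k ω, T k ω)) inferInstance

/-- `(ξ, T)` is a time-homogeneous Markov renewal sequence with kernel `K` and a free initial
condition: the joint law of the initial state `ξ 0`, the first jump time `T 1` and the state `ξ 1`
entered then is arbitrary (so that it can be chosen to make the semi-Markov process stationary),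
while all the later transitions follow the kernel. -/
structure IsMarkovRenewal {Ω : Type*} [MeasurableSpace Ω] {E : Finset ℝ} (ξ T : ℕ → Ω → ℝ)
    (K : SemiMarkovKernel E) (P : Measure Ω) : Prop where
  measurable_state : ∀ n, Measurable (ξ n)
  measurable_time : ∀ n, Measurable (T n)
  state_mem : ∀ᵐ ω ∂P, ∀ n, ξ n ω ∈ E
  time_zero : ∀ᵐ ω ∂P, T 0 ω = 0
  time_mono : ∀ᵐ ω ∂P, ∀ n, T n ω ≤ T (n + 1) ω
  transition : ∀ n, 1 ≤ n → ∀ j ∈ E, ∀ t : ℝ, 0 ≤ t →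
    P⟦{ω | ξ (n + 1) ω = j ∧ T (n + 1) ω - T n ω ≤ t} | renewalHistory ξ T n⟧
      =ᵐ[P] fun ω => K.Q (ξ n ω) j t

/-- The process `(X t)_{t ≥ 0}` is (strictly) stationary. -/
def IsStationaryProcess {Ω : Type*} [MeasurableSpace Ω] (X : ℝ → Ω → ℝ) (P : Measure Ω) : Prop :=
  ∀ h : ℝ≥0, IdentDistrib (fun ω (t : ℝ≥0) => X (t + h) ω) (fun ω (t : ℝ≥0) => X t ω) P P

/-- The stationary distribution of a stationary process: the law of `X t`, which does not depend on
`t ≥ 0` (see `map_eq_stationaryDistribution`). -/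
def stationaryDistribution {Ω : Type*} [MeasurableSpace Ω] (X : ℝ → Ω → ℝ) (P : Measure Ω) :
    Measure ℝ :=
  P.map (X 0)

theorem map_eq_stationaryDistribution {Ω : Type*} [MeasurableSpace Ω] {X : ℝ → Ω → ℝ}
    {P : Measure Ω} (hX : IsStationaryProcess X P) (t : ℝ) (ht : 0 ≤ t) :
    P.map (X t) = stationaryDistribution X P := by
  have h := ((hX ⟨t, ht⟩).comp (measurable_pi_apply (0 : ℝ≥0))).map_eq
  have h1 : ((fun f : ℝ≥0 → ℝ => f 0) ∘
      fun ω (s : ℝ≥0) => X (s + ((⟨t, ht⟩ : ℝ≥0) : ℝ)) ω) = X t := by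
    funext ω
    simp
  have h2 : ((fun f : ℝ≥0 → ℝ => f 0) ∘ fun ω (s : ℝ≥0) => X s ω) = X 0 := by
    funext ω
    simp
  unfold stationaryDistribution
  exact (congrArg (fun g => P.map g) h1).symm.trans (h.trans (congrArg (fun g => P.map g) h2))

/-- A standard (unit rate) Poisson process. -/
structure IsStandardPoissonProcess {Ω : Type*} [MeasurableSpace Ω] (Y : ℝ≥0 → Ω → ℕ)
    (P : Measure Ω) : Prop where
  measurable : ∀ t, Measurable (Y t)
  zero : ∀ᵐ ω ∂P, Y 0 ω = 0
  monotone : ∀ᵐ ω ∂P, Monotone (fun t => Y t ω)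
  right_continuous : ∀ᵐ ω ∂P, ∀ t, ContinuousWithinAt (fun s => Y s ω) (Ici t) t
  indep_increments : HasIndepIncrements Y P
  law_increment : ∀ s t : ℝ≥0, s ≤ t → HasLaw (fun ω => Y t ω - Y s ω) (poissonMeasure (t - s)) P

/-- Nonnegative rate functions on `E × ℝ` that are uniformly bounded and, for each mood `x ∈ E`,
continuously differentiable in the price variable with uniformly bounded derivative. -/
structure IsRateFunction (E : Finset ℝ) (lam : ℝ → ℝ → ℝ) : Prop where
  nonneg : ∀ x ∈ E, ∀ s, 0 ≤ lam x s
  bounded : ∃ C : ℝ, ∀ x ∈ E, ∀ s, lam x s ≤ C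
  contDiff : ∀ x ∈ E, ContDiff ℝ 1 (lam x)
  deriv_bounded : ∃ L : ℝ, ∀ x ∈ E, ∀ s, |deriv (lam x) s| ≤ L

/-- The order rate accumulated up to time `t` by the first `N` agents with mood paths `x a`, when
the logarithmic price follows the path `S`. -/
def totalRate (lam : ℝ → ℝ → ℝ) (x : ℕ → ℝ → ℝ) (N : ℕ) (S : ℝ → ℝ) (t : ℝ) : ℝ :=
  ∑ a ∈ Finset.range N, ∫ u in (0 : ℝ)..t, lam (x a u) (S u)

/-- `S` is a path of the logarithmic price in the market of the first `N` agents with mood paths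
`x a`, buying and selling rates `lamP`, `lamM`, and paths `YP`, `YM` of the two driving Poisson
processes: for all `t ≥ 0` the accumulated order rates exist and
`S t = (1/N) YP (∑ a, ∫₀ᵗ lamP (x a u) (S u) du) - (1/N) YM (∑ a, ∫₀ᵗ lamM (x a u) (S u) du)`. -/
def IsLogPricePath (lamP lamM : ℝ → ℝ → ℝ) (x : ℕ → ℝ → ℝ) (YP YM : ℝ≥0 → ℕ) (N : ℕ)
    (S : ℝ → ℝ) : Prop :=
  ∀ t : ℝ, 0 ≤ t →
    (∀ a < N, IntervalIntegrable (fun u => lamP (x a u) (S u)) volume 0 t) ∧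
    (∀ a < N, IntervalIntegrable (fun u => lamM (x a u) (S u)) volume 0 t) ∧
    S t = (1 / (N : ℝ)) * (YP (totalRate lamP x N S t).toNNReal : ℝ)
      - (1 / (N : ℝ)) * (YM (totalRate lamM x N S t).toNNReal : ℝ)

/-- The average `∫ lam(x, s) ν(dx)` of a rate function over the distribution `ν` of moods. -/
def averageRate (lam : ℝ → ℝ → ℝ) (ν : Measure ℝ) (s : ℝ) : ℝ := ∫ x, lam x s ∂ν

/-- The expected excess order flow at the logarithmic price level `s`. -/
def averageNetRate (lamP lamM : ℝ → ℝ → ℝ) (ν : Measure ℝ) (s : ℝ) : ℝ :=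
  averageRate lamP ν s - averageRate lamM ν s

/-- `s` solves `ds/dt = v(s)` on `[0, ∞)` with `s 0 = 0`. -/
def IsFluidSolution (v : ℝ → ℝ) (s : ℝ → ℝ) : Prop :=
  s 0 = 0 ∧ ∀ t : ℝ, 0 ≤ t → HasDerivWithinAt s (v (s t)) (Ici 0) t

end

/-! The price is a difference of two Poisson paths run along random clocks of order `N` and divided
by `N`. A monotone path with `Y n / n → 1` satisfies `Y R / N ≈ R / N` uniformly for `R ≤ B * N`
(`eventually_abs_rescaled_sub_le`), so both Poisson paths can be replaced by their clocks.

The moods at a fixed time are i.i.d. with the stationary law, so their frequencies converge almost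
surely. Fubini turns this into convergence at almost every time, almost surely
(`ae_ae_tendsto_moodFrequency`), and dominated convergence makes the time integral of the
discrepancy vanish. This discrepancy does not involve the price, so the feedback of the price on the
rates costs only a Lipschitz term (`abs_totalRate_div_sub_integral_le`).

Hence `|S - s|` is at most a small constant plus `K` times its own integral, and Grönwall's
inequality concludes. Probability enters only in the choice of an almost sure event; the rest is
deterministic (`tendstoUniformlyOn_of_isLogPricePath`). -/

/-! ### Grönwall's inequality and the limiting ODE -/

/-- **Grönwall's inequality**, integral form with constant coefficients, for a function that need
not be continuous. -/
theorem le_mul_exp_of_le_add_mul_integral {u : ℝ → ℝ} {δ L b : ℝ} (hL : 0 ≤ L) (hb : 0 ≤ b)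
    (hu : IntervalIntegrable u volume 0 b)
    (h : ∀ t ∈ Icc 0 b, u t ≤ δ + L * ∫ r in (0 : ℝ)..t, u r) :
    ∀ t ∈ Icc 0 b, u t ≤ δ * Real.exp (L * t) := by
  set g : ℝ → ℝ := fun t => δ + L * ∫ r in (0 : ℝ)..t, u r with hg
  have hgc : ContinuousOn g (Icc 0 b) := by
    have := intervalIntegral.continuousOn_primitive_interval' hu left_mem_uIcc
    rw [uIcc_of_le hb] at this
    exact continuousOn_const.add (continuousOn_const.mul this)
  have hgi : ∀ t ∈ Icc 0 b, IntervalIntegrable g volume 0 t := fun t ht =>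
    (hgc.mono (by rw [uIcc_of_le ht.1]; exact Icc_subset_Icc_right ht.2)).intervalIntegrable
  have hui : ∀ t ∈ Icc 0 b, IntervalIntegrable u volume 0 t := fun t ht =>
    hu.mono_set (by rw [uIcc_of_le ht.1, uIcc_of_le hb]; exact Icc_subset_Icc_right ht.2)
  -- `u` may jump, so the integral bound is iterated once: `u ≤ g ≤ k`, where `g` is continuous and
  -- `k` has right derivative `L * g ≤ L * k`.
  set k : ℝ → ℝ := fun t => δ + L * ∫ r in (0 : ℝ)..t, g r with hk
  have hgk : ∀ t ∈ Icc 0 b, g t ≤ k t := fun t ht => by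
    have := intervalIntegral.integral_mono_on ht.1 (hui t ht) (hgi t ht)
      (fun r hr => h r ⟨hr.1, hr.2.trans ht.2⟩)
    exact add_le_add le_rfl (mul_le_mul_of_nonneg_left this hL)
  have hkd : ∀ t ∈ Ico 0 b, HasDerivWithinAt k (L * g t) (Ici t) t := fun t ht => by
    have hlt : Icc 0 b ∈ 𝓝[>] t :=
      mem_of_superset (Ioc_mem_nhdsGT ht.2) fun x hx => ⟨ht.1.trans hx.1.le, hx.2⟩
    have hm : StronglyMeasurableAtFilter g (𝓝[>] t) volume :=
      ⟨Icc 0 b, hlt, hgc.aestronglyMeasurable measurableSet_Icc⟩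
    have hc : ContinuousWithinAt g (Ioi t) t :=
      (hgc t ⟨ht.1, ht.2.le⟩).mono_of_mem_nhdsWithin hlt
    exact ((intervalIntegral.integral_hasDerivWithinAt_right (hgi t ⟨ht.1, ht.2.le⟩) hm
      hc).const_mul L).const_add δ
  have hkc : ContinuousOn k (Icc 0 b) := by
    have := intervalIntegral.continuousOn_primitive_interval' (hgi b ⟨hb, le_rfl⟩) left_mem_uIcc
    rw [uIcc_of_le hb] at this
    exact continuousOn_const.add (continuousOn_const.mul this)
  intro t ht
  have key := le_gronwallBound_of_liminf_deriv_right_le (f' := fun t => L * g t) (δ := δ) (K := L)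
    (ε := 0) hkc (fun x hx r hr => (hkd x hx).liminf_right_slope_le hr) (by simp [hk])
    (fun x hx => by
      have := mul_le_mul_of_nonneg_left (hgk x ⟨hx.1, hx.2.le⟩) hL
      simpa using this) t ht
  rw [gronwallBound_ε0, sub_zero] at key
  exact (h t ht).trans ((hgk t ht).trans key)

theorem IsFluidSolution.continuousOn {v s : ℝ → ℝ} (hs : IsFluidSolution v s) :
    ContinuousOn s (Ici 0) := fun t ht => (hs.2 t ht).continuousWithinAt

theorem IsFluidSolution.integral_eq {v s : ℝ → ℝ} (hv : Continuous v) (hs : IsFluidSolution v s)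
    {t : ℝ} (ht : 0 ≤ t) : s t = ∫ r in (0 : ℝ)..t, v (s r) := by
  have hc : ContinuousOn s (Icc 0 t) := hs.continuousOn.mono Icc_subset_Ici_self
  rw [intervalIntegral.integral_eq_sub_of_hasDeriv_right_of_le ht hc
    (fun x hx => (hs.2 x hx.1.le).mono fun y hy => hx.1.le.trans (mem_Ioi.1 hy).le), hs.1, sub_zero]
  exact ((hv.comp_continuousOn hc).mono (by rw [uIcc_of_le ht])).intervalIntegrable

theorem IsFluidSolution.eqOn {v s s' : ℝ → ℝ} {K : ℝ≥0} (hv : LipschitzWith K v)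
    (hs : IsFluidSolution v s) (hs' : IsFluidSolution v s') : EqOn s' s (Ici 0) := fun t ht =>
  ODE_solution_unique_of_mem_Icc_right (v := fun _ => v) (s := fun _ => univ) (K := K) (a := 0)
    (b := t) (fun _ _ => hv.lipschitzOnWith) (hs'.continuousOn.mono Icc_subset_Ici_self)
    (fun r hr => (hs'.2 r hr.1).mono (Ici_subset_Ici.2 hr.1)) (fun _ _ => mem_univ _)
    (hs.continuousOn.mono Icc_subset_Ici_self)
    (fun r hr => (hs.2 r hr.1).mono (Ici_subset_Ici.2 hr.1)) (fun _ _ => mem_univ _)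
    (hs'.1.trans hs.1.symm) ⟨ht, le_rfl⟩

/-- A bounded Lipschitz vector field on the line has a global forward solution. -/
theorem exists_isFluidSolution {v : ℝ → ℝ} {K M : ℝ≥0} (hv : LipschitzWith K v)
    (hM : ∀ s, ‖v s‖ ≤ M) : ∃ s, IsFluidSolution v s := by
  have loc : ∀ n : ℕ, ∃ α : ℝ → ℝ, α 0 = 0 ∧
      ∀ t ∈ Icc (0 : ℝ) (n + 1), HasDerivWithinAt α (v (α t)) (Icc (0 : ℝ) (n + 1)) t := fun n => by
    -- With speed at most `M`, a solution stays within `M * (n + 1)` of its start up to time `n +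
    -- 1`; this radius therefore imposes no restriction on time.
    have hpl : IsPicardLindelof (fun _ => v) (tmin := 0) (tmax := (n : ℝ) + 1)
        ⟨0, le_rfl, by positivity⟩ (0 : ℝ) (M * (n + 1)) 0 M K :=
      IsPicardLindelof.of_time_independent (fun x _ => hM x) hv.lipschitzOnWith (by
        have : (0 : ℝ) ≤ n + 1 := by positivity
        simp [max_eq_left this])
    exact hpl.exists_eq_forall_mem_Icc_hasDerivWithinAt₀
  choose α hα0 hα using loc
  have agree : ∀ m n : ℕ, m ≤ n → EqOn (α n) (α m) (Icc (0 : ℝ) (m + 1)) := fun m n hmn => by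
    have hmn' : (m : ℝ) + 1 ≤ n + 1 := by gcongr
    have hd : ∀ k : ℕ, m ≤ k → ∀ r ∈ Ico (0 : ℝ) (m + 1),
        HasDerivWithinAt (α k) (v (α k r)) (Ici r) r := fun k hk r hr => by
      have hmk : (m : ℝ) + 1 ≤ k + 1 := by gcongr
      refine (hα k r ⟨hr.1, (hr.2.le).trans hmk⟩).mono_of_mem_nhdsWithin ?_
      exact mem_of_superset (Icc_mem_nhdsGE (hr.2.trans_le hmk))
        fun x hx => ⟨hr.1.trans hx.1, hx.2⟩
    exact ODE_solution_unique_of_mem_Icc_right (v := fun _ => v) (s := fun _ => univ) (K := K)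
      (fun _ _ => hv.lipschitzOnWith)
      (fun r hr => (hα n r ⟨hr.1, hr.2.trans hmn'⟩).continuousWithinAt.mono
        (Icc_subset_Icc_right hmn')) (hd n hmn) (fun _ _ => mem_univ _)
      (fun r hr => (hα m r hr).continuousWithinAt) (hd m le_rfl) (fun _ _ => mem_univ _)
      ((hα0 n).trans (hα0 m).symm)
  -- The solution number `⌊t⌋₊` lives up to `⌊t⌋₊ + 1 > t`, which leaves room to differentiate at
  -- `t`.
  have glue : ∀ (n : ℕ) (t : ℝ), t ∈ Ico (0 : ℝ) (n + 1) → α ⌊t⌋₊ t = α n t := fun n t ht => by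
    have h1 : ⌊t⌋₊ ≤ n := Nat.lt_succ_iff.1 ((Nat.floor_lt ht.1).2 (by exact_mod_cast ht.2))
    exact (agree _ _ h1 ⟨ht.1, (Nat.lt_floor_add_one t).le⟩).symm
  refine ⟨fun t => α ⌊t⌋₊ t, by simp [hα0], fun t ht => ?_⟩
  have hlt := Nat.lt_floor_add_one t
  have hI : Ico (0 : ℝ) (⌊t⌋₊ + 1) ∈ 𝓝[Ici 0] t := by
    rw [← Ici_inter_Iio]
    exact inter_mem self_mem_nhdsWithin (mem_nhdsWithin_of_mem_nhds (Iio_mem_nhds hlt))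
  refine HasDerivWithinAt.congr_of_eventuallyEq
    ((hα ⌊t⌋₊ t ⟨ht, hlt.le⟩).mono_of_mem_nhdsWithin (mem_of_superset hI Ico_subset_Icc_self)) ?_ rfl
  filter_upwards [hI] with x hx using glue _ x hx

/-! ### Uniform law of large numbers for a rescaled monotone path -/

/-- A monotone path that satisfies the law of large numbers along the integers is, after fluid
rescaling, uniformly close to the identity. -/
theorem eventually_abs_rescaled_sub_le {Y : ℝ≥0 → ℕ} (hmono : Monotone Y)
    (hlim : Tendsto (fun n : ℕ => (Y n : ℝ) / n) atTop (𝓝 1)) {B ε : ℝ} (hB : 0 ≤ B)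
    (hε : 0 < ε) :
    ∀ᶠ N : ℕ in atTop, ∀ R ∈ Icc 0 (B * N), |1 / (N : ℝ) * (Y R.toNNReal : ℝ) - R / N| ≤ ε := by
  -- A relative error `δ` on `[0, B * N]` costs `δ * B` after division by `N`.
  obtain ⟨δ, hδ, hδB⟩ : ∃ δ : ℝ, 0 < δ ∧ δ * B ≤ ε / 2 :=
    ⟨ε / 2 / (B + 1), by positivity, by
      rw [div_mul_eq_mul_div]
      exact div_le_of_le_mul₀ (by positivity) (by positivity) (by nlinarith)⟩
  obtain ⟨n₀, hn₀⟩ : ∃ n₀ : ℕ, ∀ n ≥ n₀, |(Y n : ℝ) - n| ≤ δ * n := by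
    obtain ⟨n₀, h⟩ := Metric.tendsto_atTop.1 hlim δ hδ
    refine ⟨n₀ + 1, fun n hn => ?_⟩
    have hn1 : (0 : ℝ) < n := by exact_mod_cast (by omega : 0 < n)
    have := (h n (by omega)).le
    rw [Real.dist_eq, div_sub_one hn1.ne', abs_div, abs_of_pos hn1, div_le_iff₀ hn1] at this
    exact this
  -- The finitely many `n` below `n₀` are absorbed into a constant, which division by `N` kills.
  obtain ⟨c, hc0, hc⟩ : ∃ c : ℝ, 0 ≤ c ∧ ∀ n : ℕ, |(Y n : ℝ) - n| ≤ δ * n + c := by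
    refine ⟨∑ k ∈ Finset.range n₀, |(Y k : ℝ) - k|,
      Finset.sum_nonneg fun _ _ => abs_nonneg _, fun n => ?_⟩
    rcases le_or_gt n₀ n with h | h
    · exact (hn₀ n h).trans (le_add_of_nonneg_right (Finset.sum_nonneg fun _ _ => abs_nonneg _))
    · exact (Finset.single_le_sum (f := fun k : ℕ => |(Y k : ℝ) - k|) (fun _ _ => abs_nonneg _)
        (Finset.mem_range.2 h)).trans (le_add_of_nonneg_left (by positivity))
  -- Monotonicity squeezes `Y R` between its values at `⌊R⌋₊` and `⌊R⌋₊ + 1`; the rounding costs `1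
  -- + δ`.
  have hR : ∀ R : ℝ, 0 ≤ R → |(Y R.toNNReal : ℝ) - R| ≤ δ * R + (1 + δ + c) := fun R hR => by
    have h1 : (Y (⌊R⌋₊ : ℕ) : ℝ) ≤ Y R.toNNReal := by
      exact_mod_cast hmono (NNReal.coe_le_coe.1 (by
        simpa [Real.coe_toNNReal _ hR] using Nat.floor_le hR))
    have h2 : (Y R.toNNReal : ℝ) ≤ Y ((⌊R⌋₊ + 1 : ℕ) : ℝ≥0) := by
      exact_mod_cast hmono (NNReal.coe_le_coe.1 (by
        simpa [Real.coe_toNNReal _ hR] using (Nat.lt_floor_add_one R).le))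
    have h3 := abs_le.1 (hc ⌊R⌋₊)
    have h4 := abs_le.1 (hc (⌊R⌋₊ + 1))
    push_cast at h2 h4
    have h5 := Nat.floor_le hR
    have h6 := (Nat.lt_floor_add_one R).le
    rw [abs_le]
    constructor <;> nlinarith
  have hev : ∀ᶠ N : ℕ in atTop, (1 + δ + c) / (N : ℝ) ≤ ε / 2 :=
    (tendsto_const_div_atTop_nhds_zero_nat (1 + δ + c)).eventually (ge_mem_nhds (by positivity))
  filter_upwards [hev, eventually_ge_atTop 1] with N hN hN1 R hRm
  have hNpos : (0 : ℝ) < N := by exact_mod_cast hN1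
  have : 1 / (N : ℝ) * (Y R.toNNReal : ℝ) - R / N = ((Y R.toNNReal : ℝ) - R) / N := by ring
  rw [this, abs_div, abs_of_pos hNpos]
  calc |(Y R.toNNReal : ℝ) - R| / N ≤ (δ * R + (1 + δ + c)) / N := by
        gcongr; exact hR R hRm.1
    _ ≤ (δ * (B * N) + (1 + δ + c)) / N := by gcongr; exact hRm.2
    _ = δ * B + (1 + δ + c) / N := by field_simp
    _ ≤ ε := by linarith

/-! ### Empirical frequencies of the moods -/

/-- The proportion of the first `N` agents that are in the mood `j` at time `t`. -/
noncomputable def moodFrequency (x : ℕ → ℝ → ℝ) (N : ℕ) (j t : ℝ) : ℝ :=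
  (∑ a ∈ Finset.range N, ({j} : Set ℝ).indicator (fun _ => (1 : ℝ)) (x a t)) / N

theorem moodFrequency_mem_Icc (x : ℕ → ℝ → ℝ) (N : ℕ) (j t : ℝ) :
    moodFrequency x N j t ∈ Icc (0 : ℝ) 1 := by
  have h0 : ∀ a, 0 ≤ ({j} : Set ℝ).indicator (fun _ => (1 : ℝ)) (x a t) := fun a =>
    indicator_nonneg (fun _ _ => zero_le_one) _
  refine ⟨div_nonneg (Finset.sum_nonneg fun a _ => h0 a) (by positivity),
    div_le_one_of_le₀ ?_ (by positivity)⟩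
  refine (Finset.sum_le_card_nsmul _ _ 1 fun a _ => ?_).trans (by simp)
  exact indicator_le_self' (f := fun _ => (1 : ℝ)) (fun _ _ => zero_le_one) (x a t)

theorem measurable_moodFrequency {x : ℕ → ℝ → ℝ} (hx : ∀ a, Measurable (x a)) (N : ℕ) (j : ℝ) :
    Measurable (moodFrequency x N j) :=
  (Finset.measurable_sum _ fun a _ =>
    (measurable_const.indicator (measurableSet_singleton j)).comp (hx a)).div_const _

theorem sum_div_eq_sum_moodFrequency {E : Finset ℝ} {x : ℕ → ℝ → ℝ} {t : ℝ}
    (hx : ∀ a, x a t ∈ E) (N : ℕ) (g : ℝ → ℝ) :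
    (∑ a ∈ Finset.range N, g (x a t)) / N = ∑ j ∈ E, moodFrequency x N j t * g j := by
  have : ∀ a, g (x a t) = ∑ j ∈ E, ({j} : Set ℝ).indicator (fun _ => (1 : ℝ)) (x a t) * g j :=
    fun a => by
      rw [Finset.sum_eq_single_of_mem (x a t) (hx a)]
      · simp
      · intro j _ hj
        simp [hj.symm]
  simp only [moodFrequency, Finset.sum_congr rfl fun a _ => this a]
  rw [Finset.sum_comm, Finset.sum_div]
  refine Finset.sum_congr rfl fun j _ => ?_
  rw [← Finset.sum_mul]
  ring

/-- The total variation type distance between the empirical distribution of moods and the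
weights `w`. -/
noncomputable def moodDiscrepancy (E : Finset ℝ) (w : ℝ → ℝ) (x : ℕ → ℝ → ℝ) (N : ℕ) (t : ℝ) : ℝ :=
  ∑ j ∈ E, |moodFrequency x N j t - w j|

theorem measurable_moodDiscrepancy {E : Finset ℝ} {w : ℝ → ℝ} {x : ℕ → ℝ → ℝ}
    (hx : ∀ a, Measurable (x a)) (N : ℕ) : Measurable (moodDiscrepancy E w x N) :=
  Finset.measurable_sum _ fun j _ => by
    have := ((measurable_moodFrequency hx N j).sub_const (w j)).norm
    simpa only [Real.norm_eq_abs] using this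

theorem norm_moodDiscrepancy_le (E : Finset ℝ) (w : ℝ → ℝ) (x : ℕ → ℝ → ℝ) (N : ℕ) (t : ℝ) :
    ‖moodDiscrepancy E w x N t‖ ≤ ∑ j ∈ E, (1 + |w j|) := by
  rw [moodDiscrepancy, Real.norm_of_nonneg (Finset.sum_nonneg fun _ _ => abs_nonneg _)]
  refine Finset.sum_le_sum fun j _ => (abs_sub _ _).trans ?_
  have := moodFrequency_mem_Icc x N j t
  rw [abs_of_nonneg this.1]
  linarith [this.2]

theorem intervalIntegrable_moodDiscrepancy {E : Finset ℝ} {w : ℝ → ℝ} {x : ℕ → ℝ → ℝ}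
    (hx : ∀ a, Measurable (x a)) (N : ℕ) (s t : ℝ) :
    IntervalIntegrable (moodDiscrepancy E w x N) volume s t :=
  (intervalIntegrable_const (c := ∑ j ∈ E, (1 + |w j|))).mono_fun
    (measurable_moodDiscrepancy hx N).aestronglyMeasurable
    (ae_of_all _ fun r => (norm_moodDiscrepancy_le E w x N r).trans (Real.le_norm_self _))

/-- Dominated convergence: one constant bounds all discrepancies, so convergence at almost every
time suffices and no uniformity in time is needed. -/
theorem tendsto_integral_moodDiscrepancy {E : Finset ℝ} {w : ℝ → ℝ} {x : ℕ → ℝ → ℝ}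
    (hx : ∀ a, Measurable (x a)) (hlim : ∀ᵐ t ∂volume.restrict (Ici (0 : ℝ)), ∀ j ∈ E,
      Tendsto (fun N => moodFrequency x N j t) atTop (𝓝 (w j))) {b : ℝ} (hb : 0 ≤ b) :
    Tendsto (fun N => ∫ t in (0 : ℝ)..b, moodDiscrepancy E w x N t) atTop (𝓝 0) := by
  have h := intervalIntegral.tendsto_integral_filter_of_dominated_convergence (a := 0) (b := b)
    (μ := volume) (F := moodDiscrepancy E w x) (f := fun _ => 0) (l := atTop)
    (fun _ => ∑ j ∈ E, (1 + |w j|))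
    (Eventually.of_forall fun N => (measurable_moodDiscrepancy hx N).aestronglyMeasurable)
    (Eventually.of_forall fun N => ae_of_all _ fun t _ => norm_moodDiscrepancy_le E w x N t)
    intervalIntegrable_const ?_
  · simpa using h
  · filter_upwards [(ae_restrict_iff' measurableSet_Ici).1 hlim] with t ht htm
    rw [uIoc_of_le hb] at htm
    have : Tendsto (fun N => ∑ j ∈ E, |moodFrequency x N j t - w j|) atTop
        (𝓝 (∑ j ∈ E, |w j - w j|)) :=
      tendsto_finsetSum _ fun j hj => ((ht htm.1.le j hj).sub_const _).abs
    simpa [moodDiscrepancy] using this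

/-! ### Rates, clocks and the pathwise fluid limit -/

namespace IsRateFunction

variable {E : Finset ℝ} {lam : ℝ → ℝ → ℝ}

theorem exists_lipschitz (h : IsRateFunction E lam) :
    ∃ L : ℝ≥0, ∀ x ∈ E, LipschitzWith L (lam x) := by
  obtain ⟨L, hL⟩ := h.deriv_bounded
  refine ⟨L.toNNReal, fun x hx => lipschitzWith_of_nnnorm_deriv_le
    ((h.contDiff x hx).differentiable one_ne_zero) fun s => ?_⟩
  rw [← NNReal.coe_le_coe, coe_nnnorm, Real.norm_eq_abs]
  exact (hL x hx s).trans (Real.le_coe_toNNReal L)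

theorem exists_abs_le (h : IsRateFunction E lam) : ∃ C : ℝ≥0, ∀ x ∈ E, ∀ s, |lam x s| ≤ C := by
  obtain ⟨C, hC⟩ := h.bounded
  exact ⟨C.toNNReal, fun x hx s => (abs_of_nonneg (h.nonneg x hx s)).trans_le
    ((hC x hx s).trans (Real.le_coe_toNNReal C))⟩

end IsRateFunction

/-- The accumulated rate per agent is close to the accumulated average rate, up to the distance of
the two price paths and the discrepancy of the moods. -/
theorem abs_totalRate_div_sub_integral_le {E : Finset ℝ} {lam : ℝ → ℝ → ℝ} {L C : ℝ≥0}
    (hL : ∀ x ∈ E, LipschitzWith L (lam x)) (hC : ∀ x ∈ E, ∀ s, |lam x s| ≤ C)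
    {w : ℝ → ℝ} {x : ℕ → ℝ → ℝ} (hxm : ∀ a, Measurable (x a)) (hxE : ∀ a t, x a t ∈ E)
    {N : ℕ} {S s : ℝ → ℝ} {t : ℝ} (ht : 0 ≤ t)
    (hint : ∀ a < N, IntervalIntegrable (fun u => lam (x a u) (S u)) volume 0 t)
    (hs : ContinuousOn s (Icc 0 t))
    (hSs : IntervalIntegrable (fun u => |S u - s u|) volume 0 t) :
    |totalRate lam x N S t / N - ∫ u in (0 : ℝ)..t, ∑ j ∈ E, w j * lam j (s u)| ≤
      L * (∫ u in (0 : ℝ)..t, |S u - s u|) + C * ∫ u in (0 : ℝ)..t, moodDiscrepancy E w x N u := by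
  have hsum : IntervalIntegrable (fun u => (∑ a ∈ Finset.range N, lam (x a u) (S u)) / N)
      volume 0 t :=
    (IntervalIntegrable.sum (f := fun a u => lam (x a u) (S u)) _ fun a ha =>
      hint a (Finset.mem_range.1 ha)).div_const (N : ℝ) |>.congr fun u _ => by simp
  have havg : IntervalIntegrable (fun u => ∑ j ∈ E, w j * lam j (s u)) volume 0 t := by
    refine ContinuousOn.intervalIntegrable ?_
    rw [uIcc_of_le ht]
    exact continuousOn_finsetSum _ fun j hj =>
      continuousOn_const.mul ((hL j hj).continuous.comp_continuousOn hs)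
  have hdis := intervalIntegrable_moodDiscrepancy (E := E) (w := w) hxm N 0 t
  rw [totalRate, ← intervalIntegral.integral_finsetSum fun a ha => hint a (Finset.mem_range.1 ha),
    ← intervalIntegral.integral_div, ← intervalIntegral.integral_sub hsum havg,
    ← intervalIntegral.integral_const_mul, ← intervalIntegral.integral_const_mul,
    ← intervalIntegral.integral_add (hSs.const_mul _) (hdis.const_mul _)]
  refine (intervalIntegral.abs_integral_le_integral_abs ht).trans
    (intervalIntegral.integral_mono_on ht (hsum.sub havg).abs
      ((hSs.const_mul _).add (hdis.const_mul _)) fun u _ => ?_)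
  rw [sum_div_eq_sum_moodFrequency (g := fun j => lam j (S u)) fun a => hxE a u]
  -- The error splits so that the change of price is weighted by the empirical frequencies, hence is
  -- a mean over agents with the Lipschitz bound for each, while the change of weights meets rates
  -- along `s` alone.
  have key : |∑ j ∈ E, moodFrequency x N j u * (lam j (S u) - lam j (s u))| ≤
      L * |S u - s u| := by
    rw [← sum_div_eq_sum_moodFrequency (g := fun j => lam j (S u) - lam j (s u)) fun a => hxE a u,
      abs_div, Nat.abs_cast]
    refine div_le_of_le_mul₀ (by positivity) (by positivity)
      ((Finset.abs_sum_le_sum_abs _ _).trans ?_)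
    refine (Finset.sum_le_card_nsmul _ _ (L * |S u - s u|) fun a _ => ?_).trans (by
      simp [mul_comm])
    exact (hL _ (hxE a u)).dist_le_mul (S u) (s u)
  have key2 : |∑ j ∈ E, (moodFrequency x N j u - w j) * lam j (s u)| ≤
      C * moodDiscrepancy E w x N u := by
    rw [moodDiscrepancy, Finset.mul_sum]
    refine (Finset.abs_sum_le_sum_abs _ _).trans (Finset.sum_le_sum fun j hj => ?_)
    rw [abs_mul, mul_comm]
    exact mul_le_mul_of_nonneg_right (hC j hj _) (abs_nonneg _)
  have hsplit : ∑ j ∈ E, moodFrequency x N j u * lam j (S u) - ∑ j ∈ E, w j * lam j (s u) =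
      ∑ j ∈ E, moodFrequency x N j u * (lam j (S u) - lam j (s u)) +
        ∑ j ∈ E, (moodFrequency x N j u - w j) * lam j (s u) := by
    rw [← Finset.sum_sub_distrib, ← Finset.sum_add_distrib]
    exact Finset.sum_congr rfl fun j _ => by ring
  rw [hsplit]
  exact (abs_add_le _ _).trans (add_le_add key key2)

theorem monotoneOn_totalRate {E : Finset ℝ} {lam : ℝ → ℝ → ℝ}
    (h0 : ∀ x ∈ E, ∀ s, 0 ≤ lam x s) {x : ℕ → ℝ → ℝ} (hxE : ∀ a t, x a t ∈ E) {N : ℕ} {S : ℝ → ℝ}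
    (hint : ∀ t, 0 ≤ t → ∀ a < N, IntervalIntegrable (fun u => lam (x a u) (S u)) volume 0 t) :
    MonotoneOn (totalRate lam x N S) (Ici 0) := fun _ hs t ht hst =>
  Finset.sum_le_sum fun a ha => intervalIntegral.integral_mono_interval le_rfl hs hst
    (ae_of_all _ fun u => h0 _ (hxE a u) _) (hint t ht a (Finset.mem_range.1 ha))

/-- Confines the clock to a window of length proportional to `N`, where the rescaled law of large
numbers is uniform. -/
theorem totalRate_mem_Icc {E : Finset ℝ} {lam : ℝ → ℝ → ℝ}
    (h0 : ∀ x ∈ E, ∀ s, 0 ≤ lam x s) {C : ℝ≥0} (hC : ∀ x ∈ E, ∀ s, |lam x s| ≤ C)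
    {x : ℕ → ℝ → ℝ} (hxE : ∀ a t, x a t ∈ E) {N : ℕ} {S : ℝ → ℝ} {t b : ℝ} (ht : t ∈ Icc 0 b)
    (hint : ∀ a < N, IntervalIntegrable (fun u => lam (x a u) (S u)) volume 0 t) :
    totalRate lam x N S t ∈ Icc 0 (C * b * N) := by
  refine ⟨Finset.sum_nonneg fun a _ => intervalIntegral.integral_nonneg ht.1 fun u _ =>
    h0 _ (hxE a u) _, ?_⟩
  refine (Finset.sum_le_card_nsmul _ _ (C * b) fun a ha => ?_).trans (by simp [mul_comm])
  refine (intervalIntegral.integral_mono_on ht.1 (hint a (Finset.mem_range.1 ha))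
    intervalIntegrable_const fun u _ => (le_abs_self _).trans (hC _ (hxE a u) (S u))).trans ?_
  rw [intervalIntegral.integral_const, sub_zero, smul_eq_mul, mul_comm]
  exact mul_le_mul_of_nonneg_left ht.2 C.2

/-- Nonnegative rates make the clocks nondecreasing, so `S` is a difference of monotone functions on
`[0, t]`. -/
theorem IsLogPricePath.intervalIntegrable {E : Finset ℝ} {lamP lamM : ℝ → ℝ → ℝ}
    (h0P : ∀ x ∈ E, ∀ s, 0 ≤ lamP x s) (h0M : ∀ x ∈ E, ∀ s, 0 ≤ lamM x s)
    {x : ℕ → ℝ → ℝ} (hxE : ∀ a t, x a t ∈ E) {YP YM : ℝ≥0 → ℕ} (hYP : Monotone YP)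
    (hYM : Monotone YM) {N : ℕ} {S : ℝ → ℝ} (hS : IsLogPricePath lamP lamM x YP YM N S) {t : ℝ}
    (ht : 0 ≤ t) : IntervalIntegrable S volume 0 t := by
  have aux : ∀ (Y : ℝ≥0 → ℕ) (R : ℝ → ℝ), Monotone Y → MonotoneOn R (Ici 0) →
      IntervalIntegrable (fun u => (Y (R u).toNNReal : ℝ)) volume 0 t := fun Y R hY hR =>
    MonotoneOn.intervalIntegrable fun u hu v hv huv => by
      rw [uIcc_of_le ht] at hu hv
      exact Nat.cast_le.2 (hY (Real.toNNReal_mono (hR hu.1 hv.1 huv)))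
  refine (((aux YP _ hYP (monotoneOn_totalRate h0P hxE fun r hr => (hS r hr).1)).const_mul
    (1 / (N : ℝ))).sub ((aux YM _ hYM (monotoneOn_totalRate h0M hxE fun r hr =>
    (hS r hr).2.1)).const_mul (1 / (N : ℝ)))).congr fun u hu => ?_
  rw [uIoc_of_le ht] at hu
  exact (hS u hu.1.le).2.2.symm

/-- Pathwise fluid limit: if the Poisson paths obey the law of large numbers and the proportions of
the moods converge at almost every time, then the price paths converge uniformly on compacts. -/
theorem tendstoUniformlyOn_of_isLogPricePath {E : Finset ℝ} {lamP lamM : ℝ → ℝ → ℝ}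
    (hlamP : IsRateFunction E lamP) (hlamM : IsRateFunction E lamM) {w : ℝ → ℝ}
    {x : ℕ → ℝ → ℝ} (hxm : ∀ a, Measurable (x a)) (hxE : ∀ a t, x a t ∈ E)
    (hw : ∀ᵐ t ∂volume.restrict (Ici (0 : ℝ)), ∀ j ∈ E,
      Tendsto (fun N => moodFrequency x N j t) atTop (𝓝 (w j)))
    {YP YM : ℝ≥0 → ℕ} (hYP : Monotone YP) (hYM : Monotone YM)
    (hlimP : Tendsto (fun n : ℕ => (YP n : ℝ) / n) atTop (𝓝 1))
    (hlimM : Tendsto (fun n : ℕ => (YM n : ℝ) / n) atTop (𝓝 1))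
    {S : ℕ → ℝ → ℝ} (hS : ∀ N, 1 ≤ N → IsLogPricePath lamP lamM x YP YM N (S N))
    {s : ℝ → ℝ} (hs : IsFluidSolution
      (fun r => ∑ j ∈ E, w j * lamP j r - ∑ j ∈ E, w j * lamM j r) s) {b : ℝ} (hb : 0 ≤ b) :
    TendstoUniformlyOn S s atTop (Icc 0 b) := by
  obtain ⟨LP, hLP⟩ := hlamP.exists_lipschitz
  obtain ⟨LM, hLM⟩ := hlamM.exists_lipschitz
  obtain ⟨CP, hCP⟩ := hlamP.exists_abs_le
  obtain ⟨CM, hCM⟩ := hlamM.exists_abs_le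
  have hcont : ∀ lam : ℝ → ℝ → ℝ, IsRateFunction E lam →
      Continuous fun r => ∑ j ∈ E, w j * lam j r := fun lam h =>
    continuous_finsetSum _ fun j hj => continuous_const.mul (h.contDiff j hj).continuous
  have hsc : ContinuousOn s (Icc 0 b) := hs.continuousOn.mono Icc_subset_Ici_self
  set K : ℝ := LP + LM with hK
  have hK0 : 0 ≤ K := by positivity
  rw [Metric.tendstoUniformlyOn_iff]
  intro ε hε
  -- Three errors of size `η` arise, two from the Poisson paths and one from the moods; after the
  -- Grönwall factor they total `3 / 4 * ε`.
  set η := ε / (4 * Real.exp (K * b)) with hη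
  have hη0 : 0 < η := by positivity
  have hD : Tendsto (fun N => (CP + CM : ℝ) * ∫ t in (0 : ℝ)..b, moodDiscrepancy E w x N t) atTop
      (𝓝 0) := by
    simpa using (tendsto_integral_moodDiscrepancy hxm hw hb).const_mul (CP + CM : ℝ)
  filter_upwards [eventually_abs_rescaled_sub_le hYP hlimP (B := CP * b) (by positivity) hη0,
    eventually_abs_rescaled_sub_le hYM hlimM (B := CM * b) (by positivity) hη0,
    hD.eventually (ge_mem_nhds hη0), eventually_ge_atTop 1] with N hNP hNM hND hN1
  have hN := hS N hN1
  have hSi := hN.intervalIntegrable hlamP.nonneg hlamM.nonneg hxE hYP hYM hb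
  have hdi : IntervalIntegrable (fun u => |S N u - s u|) volume 0 b :=
    (hSi.sub (ContinuousOn.intervalIntegrable (by rwa [uIcc_of_le hb]))).abs
  have hbound : ∀ t ∈ Icc 0 b,
      |S N t - s t| ≤ 3 * η + K * ∫ u in (0 : ℝ)..t, |S N u - s u| := fun t ht => by
    have hsub : uIcc 0 t ⊆ uIcc 0 b := by
      rw [uIcc_of_le ht.1, uIcc_of_le hb]; exact Icc_subset_Icc_right ht.2
    have hst : ContinuousOn s (Icc 0 t) := hsc.mono (Icc_subset_Icc_right ht.2)
    obtain ⟨hiP, hiM, hSt⟩ := hN t ht.1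
    have h1 := hNP _ (totalRate_mem_Icc hlamP.nonneg hCP hxE ht hiP)
    have h2 := hNM _ (totalRate_mem_Icc hlamM.nonneg hCM hxE ht hiM)
    have h3 := abs_totalRate_div_sub_integral_le hLP hCP (w := w) hxm hxE ht.1 hiP hst
      (hdi.mono_set hsub)
    have h4 := abs_totalRate_div_sub_integral_le hLM hCM (w := w) hxm hxE ht.1 hiM hst
      (hdi.mono_set hsub)
    have h5 : ∫ u in (0 : ℝ)..t, moodDiscrepancy E w x N u ≤
        ∫ u in (0 : ℝ)..b, moodDiscrepancy E w x N u :=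
      intervalIntegral.integral_mono_interval le_rfl ht.1 ht.2
        (ae_of_all _ fun u => Finset.sum_nonneg fun _ _ => abs_nonneg _)
        (intervalIntegrable_moodDiscrepancy hxm N 0 b)
    have h6 : (CP + CM : ℝ) * ∫ u in (0 : ℝ)..t, moodDiscrepancy E w x N u ≤ η :=
      (mul_le_mul_of_nonneg_left h5 (by positivity)).trans hND
    have hii : ∀ lam : ℝ → ℝ → ℝ, IsRateFunction E lam →
        IntervalIntegrable (fun u => ∑ j ∈ E, w j * lam j (s u)) volume 0 t := fun lam h =>
      ContinuousOn.intervalIntegrable (by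
        rw [uIcc_of_le ht.1]; exact (hcont lam h).comp_continuousOn hst)
    have h7 := hs.integral_eq ((hcont _ hlamP).sub (hcont _ hlamM)) ht.1
    simp only [Pi.sub_apply] at h7
    rw [intervalIntegral.integral_sub (hii _ hlamP) (hii _ hlamM)] at h7
    rw [hSt, h7]
    rw [abs_le] at h1 h2 h3 h4 ⊢
    constructor <;> linarith
  have hgron := le_mul_exp_of_le_add_mul_integral hK0 hb hdi hbound
  intro t ht
  rw [dist_comm, Real.dist_eq]
  calc |S N t - s t| ≤ 3 * η * Real.exp (K * t) := hgron t ht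
    _ ≤ 3 * η * Real.exp (K * b) := by gcongr; exact ht.2
    _ = 3 / 4 * ε := by rw [hη]; field_simp
    _ < ε := by linarith

/-! ### Law of large numbers for the Poisson process -/

theorem poissonMeasure_integrable_cast (r : ℝ≥0) :
    Integrable (fun n : ℕ => (n : ℝ)) (poissonMeasure r) := by
  rw [integrable_poissonMeasure_iff, ← summable_nat_add_iff 1]
  refine ((Real.summable_pow_div_factorial (r : ℝ)).mul_left (Real.exp (-r) * r)).congr fun n => ?_
  rw [Real.norm_of_nonneg (by positivity), Nat.factorial_succ]
  push_cast
  field_simp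
  ring

/-- The term `n = 0` vanishes, and `n + 1` times the weight of `n + 1` is `r` times the weight of
`n`; the weights sum to one. -/
theorem poissonMeasure_integral_cast (r : ℝ≥0) : ∫ n : ℕ, (n : ℝ) ∂(poissonMeasure r) = r := by
  have h := hasSum_integral_poissonMeasure (poissonMeasure_integrable_cast r)
  rw [← hasSum_nat_add_iff' 1] at h
  have h2 : HasSum (fun n : ℕ => r * (Real.exp (-r) * (r : ℝ) ^ n / (n.factorial))) (r * 1) :=
    (hasSum_one_poissonMeasure r).mul_left (r : ℝ)
  have h3 := h.unique (h2.congr_fun ?_)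
  · simpa using h3
  · intro n
    rw [Nat.factorial_succ]
    push_cast
    simp only [smul_eq_mul]
    field_simp
    ring

/-- The strong law of large numbers for a standard Poisson process along the integers. -/
theorem IsStandardPoissonProcess.tendsto_div {Ω : Type*} [MeasurableSpace Ω] {P : Measure Ω}
    {Y : ℝ≥0 → Ω → ℕ} (hY : IsStandardPoissonProcess Y P) :
    ∀ᵐ ω ∂P, Tendsto (fun n : ℕ => (Y n ω : ℝ) / n) atTop (𝓝 1) := by
  set X : ℕ → Ω → ℕ := fun n ω => Y (n + 1 : ℕ) ω - Y (n : ℕ) ω with hX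
  have hlaw : ∀ n, HasLaw (X n) (poissonMeasure 1) P := fun n => by
    have := hY.law_increment (n : ℕ) (n + 1 : ℕ) (by simp)
    simpa [hX] using this
  have hcast : Measurable (fun n : ℕ => (n : ℝ)) := measurable_from_top
  have hind : iIndepFun X P :=
    hY.indep_increments.nat (t := fun n : ℕ => (n : ℝ≥0)) Nat.mono_cast
  have hint : ∀ n, Integrable (fun ω => (X n ω : ℝ)) P := fun n => by
    have := poissonMeasure_integrable_cast 1
    rw [← (hlaw n).map_eq] at this
    exact this.comp_aemeasurable (hlaw n).aemeasurable
  have hmean : ∫ ω, (X 0 ω : ℝ) ∂P = 1 := by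
    have := poissonMeasure_integral_cast 1
    rw [← (hlaw 0).map_eq, integral_map (hlaw 0).aemeasurable hcast.aestronglyMeasurable] at this
    simpa using this
  have hslln := strong_law_ae_real (fun n ω => (X n ω : ℝ)) (hint 0)
    (fun i j hij => (hind.indepFun hij).comp hcast hcast)
    (fun i => IdentDistrib.comp (u := fun n : ℕ => (n : ℝ))
      ⟨(hlaw i).aemeasurable, (hlaw 0).aemeasurable, by
      rw [(hlaw i).map_eq, (hlaw 0).map_eq]⟩ hcast)
  rw [hmean] at hslln
  filter_upwards [hslln, hY.zero, hY.monotone] with ω h h0 hm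
  -- The unit increments telescope; monotonicity keeps the subtraction in `ℕ` from truncating.
  refine h.congr fun n => ?_
  congr 1
  induction n with
  | zero => simp [h0]
  | succ n ih =>
    rw [Finset.sum_range_succ, ih, hX]
    simp only
    rw [Nat.cast_sub (hm (by simp))]
    ring

/-! ### Measurability of the mood processes and convergence of frequencies -/

section Mood

variable {Ω : Type*}

theorem hasSum_moodProcess {ξ T : ℕ → Ω → ℝ} {ω : Ω} (hT : ∀ n, T n ω ≤ T (n + 1) ω) (t : ℝ) :
    HasSum (fun n => (Ico (T n ω) (T (n + 1) ω)).indicator (fun _ => ξ n ω) t)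
      (moodProcess ξ T t ω) := by
  refine Summable.hasSum ?_
  by_cases h : ∃ n, t ∈ Ico (T n ω) (T (n + 1) ω)
  · obtain ⟨n, hn⟩ := h
    refine (hasSum_single n fun m hm => indicator_of_notMem (fun hm' => ?_) _).summable
    exact (disjoint_left.1 ((monotone_nat_of_le_succ (f := fun n => T n ω)
      hT).pairwise_disjoint_on_Ico_succ hm)) hm' hn
  · push Not at h
    exact summable_zero.congr fun n => (indicator_of_notMem (h n) _).symm

/-- A time in none of the intervals, for instance after an explosion, gets the value `0` of the
empty sum. Since `0 ∈ E`, explosion need not be excluded. -/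
theorem moodProcess_mem {ξ T : ℕ → Ω → ℝ} {ω : Ω} {E : Finset ℝ} (hE : (0 : ℝ) ∈ E)
    (hT : ∀ n, T n ω ≤ T (n + 1) ω) (hξ : ∀ n, ξ n ω ∈ E) (t : ℝ) : moodProcess ξ T t ω ∈ E := by
  by_cases h : ∃ n, t ∈ Ico (T n ω) (T (n + 1) ω)
  · obtain ⟨n, hn⟩ := h
    rw [moodProcess, tsum_eq_single n fun m hm => indicator_of_notMem (fun hm' => ?_) _,
      indicator_of_mem hn]
    · exact hξ n
    · exact (disjoint_left.1 ((monotone_nat_of_le_succ (f := fun n => T n ω)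
        hT).pairwise_disjoint_on_Ico_succ hm)) hm' hn
  · push Not at h
    rw [moodProcess, tsum_congr fun n => indicator_of_notMem (h n) _, tsum_zero]
    exact hE

/-- A version of the mood process that is jointly measurable in time and chance. -/
noncomputable def moodVersion (ξ T : ℕ → Ω → ℝ) (p : ℝ × Ω) : ℝ :=
  limsup (fun N => ∑ n ∈ Finset.range N,
    (Ico (T n p.2) (T (n + 1) p.2)).indicator (fun _ => ξ n p.2) p.1) atTop

theorem moodVersion_eq {ξ T : ℕ → Ω → ℝ} {ω : Ω} (hT : ∀ n, T n ω ≤ T (n + 1) ω) (t : ℝ) :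
    moodVersion ξ T (t, ω) = moodProcess ξ T t ω :=
  (hasSum_moodProcess hT t).tendsto_sum_nat.limsup_eq

/-- A `limsup` of measurable partial sums is measurable on the whole product, with no appeal to the
order of the jump times, which is known only almost surely. -/
theorem measurable_moodVersion [MeasurableSpace Ω] {ξ T : ℕ → Ω → ℝ} (hξ : ∀ n, Measurable (ξ n))
    (hT : ∀ n, Measurable (T n)) : Measurable (moodVersion ξ T) := by
  refine Measurable.limsup fun N => Finset.measurable_sum _ fun n _ => ?_
  have hset : MeasurableSet {p : ℝ × Ω | T n p.2 ≤ p.1 ∧ p.1 < T (n + 1) p.2} :=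
    (measurableSet_le ((hT n).comp measurable_snd) measurable_fst).inter
      (measurableSet_lt measurable_fst ((hT (n + 1)).comp measurable_snd))
  exact ((hξ n).comp measurable_snd).indicator hset

/-- At each time the proportions of the moods obey the strong law of large numbers. -/
theorem tendsto_moodFrequency_ae [MeasurableSpace Ω] {P : Measure Ω} [IsProbabilityMeasure P]
    {X : ℕ → ℝ → Ω → ℝ} (hstat : IsStationaryProcess (X 0) P)
    (hident : ∀ a, IdentDistrib (fun ω (t : ℝ≥0) => X a t ω) (fun ω (t : ℝ≥0) => X 0 t ω) P P)
    (hindep : iIndepFun (fun a ω (t : ℝ≥0) => X a t ω) P) (j : ℝ) {t : ℝ} (ht : 0 ≤ t) :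
    ∀ᵐ ω ∂P, Tendsto (fun N => moodFrequency (fun a t => X a t ω) N j t) atTop
      (𝓝 ((stationaryDistribution (X 0) P).real {j})) := by
  set u : (ℝ≥0 → ℝ) → ℝ := fun f => ({j} : Set ℝ).indicator (fun _ => (1 : ℝ)) (f ⟨t, ht⟩) with hu
  have hum : Measurable u := (measurable_const.indicator (measurableSet_singleton j)).comp
    (measurable_pi_apply _)
  have hXm : AEMeasurable (X 0 t) P :=
    (measurable_pi_apply (⟨t, ht⟩ : ℝ≥0)).comp_aemeasurable (hident 0).aemeasurable_fst
  have hint : Integrable (fun ω => ({j} : Set ℝ).indicator (fun _ => (1 : ℝ)) (X 0 t ω)) P :=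
    Integrable.comp_aemeasurable (f := X 0 t) (g := ({j} : Set ℝ).indicator fun _ => (1 : ℝ))
      (by
        have := Measure.isProbabilityMeasure_map (μ := P) hXm
        exact (integrable_const (1 : ℝ)).indicator (measurableSet_singleton j)) hXm
  have hmean : ∫ ω, ({j} : Set ℝ).indicator (fun _ => (1 : ℝ)) (X 0 t ω) ∂P =
      (stationaryDistribution (X 0) P).real {j} := by
    rw [← map_eq_stationaryDistribution hstat t ht,
      ← integral_map (f := ({j} : Set ℝ).indicator (fun _ => (1 : ℝ))) hXm
        (measurable_const.indicator (measurableSet_singleton j)).aestronglyMeasurable,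
      integral_indicator_const _ (measurableSet_singleton j)]
    simp
  rw [← hmean]
  exact strong_law_ae_real
    (fun a ω => ({j} : Set ℝ).indicator (fun _ => (1 : ℝ)) (X a t ω)) hint
    (fun a b hab => (hindep.indepFun hab).comp hum hum) fun a => (hident a).comp hum

/-- Almost surely, the proportions of the moods converge at almost every time. -/
theorem ae_ae_tendsto_moodFrequency [MeasurableSpace Ω] {P : Measure Ω} [IsProbabilityMeasure P]
    {ξ T : ℕ → ℕ → Ω → ℝ} (hξ : ∀ a n, Measurable (ξ a n)) (hT : ∀ a n, Measurable (T a n))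
    (hmono : ∀ᵐ ω ∂P, ∀ a n, T a n ω ≤ T a (n + 1) ω)
    (hstat : IsStationaryProcess (moodProcess (ξ 0) (T 0)) P)
    (hident : ∀ a, IdentDistrib (fun ω (t : ℝ≥0) => moodProcess (ξ a) (T a) t ω)
      (fun ω (t : ℝ≥0) => moodProcess (ξ 0) (T 0) t ω) P P)
    (hindep : iIndepFun (fun a ω (t : ℝ≥0) => moodProcess (ξ a) (T a) t ω) P) (E : Finset ℝ) :
    ∀ᵐ ω ∂P, ∀ᵐ t ∂volume.restrict (Ici (0 : ℝ)), ∀ j ∈ E,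
      Tendsto (fun N => moodFrequency (fun a t => moodProcess (ξ a) (T a) t ω) N j t) atTop
        (𝓝 ((stationaryDistribution (moodProcess (ξ 0) (T 0)) P).real {j})) := by
  set w : ℝ → ℝ := fun j => (stationaryDistribution (moodProcess (ξ 0) (T 0)) P).real {j} with hw
  set q : ℝ → Ω → Prop := fun t ω => ∀ j ∈ E, Tendsto (fun N =>
    moodFrequency (fun a t => moodVersion (ξ a) (T a) (t, ω)) N j t) atTop (𝓝 (w j)) with hq
  have hqm : MeasurableSet {p : ℝ × Ω | q p.1 p.2} := by
    simp only [hq, ofPred_forall]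
    refine E.measurableSet_biInter fun j _ => measurableSet_tendsto _ fun N => ?_
    exact (Finset.measurable_sum _ fun a _ =>
      (measurable_const.indicator (measurableSet_singleton j)).comp
        (measurable_moodVersion (hξ a) (hT a))).div_const _
  have heq : ∀ ω, (∀ a n, T a n ω ≤ T a (n + 1) ω) →
      (fun a t => moodVersion (ξ a) (T a) (t, ω)) = fun a t => moodProcess (ξ a) (T a) t ω :=
    fun ω hω => by
      funext a t
      exact moodVersion_eq (hω a) t
  have h1 : ∀ᵐ t ∂volume.restrict (Ici (0 : ℝ)), ∀ᵐ ω ∂P, q t ω := by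
    filter_upwards [ae_restrict_mem measurableSet_Ici] with t ht
    have := (ae_ball_iff E.countable_toSet).2 fun j (_ : j ∈ (E : Set ℝ)) =>
      tendsto_moodFrequency_ae (X := fun a => moodProcess (ξ a) (T a)) hstat hident hindep j ht
    filter_upwards [this, hmono] with ω h hω
    simp only [hq, heq ω hω]
    exact fun j hj => h j hj
  -- Each time has its own null set. Fubini exchanges the two quantifiers, and this needs the joint
  -- measurability that the versions provide.
  filter_upwards [(Measure.ae_ae_comm hqm).1 h1, hmono] with ω h hω
  simpa only [hq, heq ω hω] using h

theorem measurable_moodProcess_path {ξ T : ℕ → Ω → ℝ} {ω : Ω} (hT : ∀ n, T n ω ≤ T (n + 1) ω) :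
    Measurable fun t => moodProcess ξ T t ω :=
  measurable_of_tendsto_metrizable
    (fun N => Finset.measurable_sum (Finset.range N) fun n _ =>
      (measurable_const (a := ξ n ω)).indicator (measurableSet_Ico (a := T n ω) (b := T (n + 1) ω)))
    (tendsto_pi_nhds.2 fun t => by
      simpa using (hasSum_moodProcess (ξ := ξ) hT t).tendsto_sum_nat)

end Mood

/-! ### The averaged vector field and the theorem -/

theorem averageRate_eq_sum {ν : Measure ℝ} [IsFiniteMeasure ν] {E : Finset ℝ}
    (hν : ∀ᵐ y ∂ν, y ∈ E) (lam : ℝ → ℝ → ℝ) (s : ℝ) :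
    averageRate lam ν s = ∑ j ∈ E, ν.real {j} * lam j s := by
  have hr : ν.restrict (E : Set ℝ) = ν := Measure.restrict_eq_self_of_ae_mem hν
  rw [averageRate, ← hr, setIntegral_finset E IntegrableOn.finset, hr]
  simp only [smul_eq_mul]

/-- The net average rate is a bounded Lipschitz vector field. -/
theorem exists_lipschitzWith_netRate {E : Finset ℝ} {lamP lamM : ℝ → ℝ → ℝ}
    (hlamP : IsRateFunction E lamP) (hlamM : IsRateFunction E lamM) (w : ℝ → ℝ) :
    ∃ K M : ℝ≥0, LipschitzWith K
        (fun r => ∑ j ∈ E, w j * lamP j r - ∑ j ∈ E, w j * lamM j r) ∧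
      ∀ r, ‖∑ j ∈ E, w j * lamP j r - ∑ j ∈ E, w j * lamM j r‖ ≤ M := by
  have aux : ∀ lam, IsRateFunction E lam → ∃ K M : ℝ≥0,
      LipschitzWith K (fun r => ∑ j ∈ E, w j * lam j r) ∧
      ∀ r, ‖∑ j ∈ E, w j * lam j r‖ ≤ M := fun lam h => by
    obtain ⟨L, hL⟩ := h.exists_lipschitz
    obtain ⟨C, hC⟩ := h.exists_abs_le
    refine ⟨∑ j ∈ E, ‖w j‖₊ * L, ∑ j ∈ E, ‖w j‖₊ * C, LipschitzWith.of_dist_le_mul fun r r' => ?_,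
      fun r => ?_⟩
    · rw [Real.dist_eq, ← Finset.sum_sub_distrib]
      push_cast
      rw [Finset.sum_mul]
      refine (Finset.abs_sum_le_sum_abs _ _).trans (Finset.sum_le_sum fun j hj => ?_)
      rw [← mul_sub, abs_mul, mul_assoc, Real.norm_eq_abs]
      exact mul_le_mul_of_nonneg_left ((hL j hj).dist_le_mul r r') (abs_nonneg _)
    · push_cast
      refine (norm_sum_le _ _).trans (Finset.sum_le_sum fun j hj => ?_)
      rw [norm_mul]
      exact mul_le_mul_of_nonneg_left (hC j hj r) (norm_nonneg _)
  obtain ⟨K, M, hK, hM⟩ := aux lamP hlamP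
  obtain ⟨K', M', hK', hM'⟩ := aux lamM hlamM
  exact ⟨K + K', M + M', hK.sub hK', fun r =>
    (norm_sub_le _ _).trans (by push_cast; exact add_le_add (hM r) (hM' r))⟩

theorem mainTheorem3 {Ω : Type*} [MeasurableSpace Ω] (P : Measure Ω) [IsProbabilityMeasure P]
    (E : Finset ℝ) (hE : (0 : ℝ) ∈ E)
    -- the rate functions
    (lamP lamM : ℝ → ℝ → ℝ) (hlamP : IsRateFunction E lamP) (hlamM : IsRateFunction E lamM)
    -- the i.i.d. stationary semi-Markov mood processes of the agents `a = 0, 1, 2, …`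
    (K : SemiMarkovKernel E) (hK : K.IsInert)
    (ξ T : ℕ → ℕ → Ω → ℝ)
    (hrenewal : ∀ a, IsMarkovRenewal (ξ a) (T a) K P)
    (hstat : ∀ a, IsStationaryProcess (moodProcess (ξ a) (T a)) P)
    (hident : ∀ a, IdentDistrib (fun ω (t : ℝ≥0) => moodProcess (ξ a) (T a) t ω)
      (fun ω (t : ℝ≥0) => moodProcess (ξ 0) (T 0) t ω) P P)
    (hindep : iIndepFun (fun a ω (t : ℝ≥0) => moodProcess (ξ a) (T a) t ω) P)
    -- the independent standard Poisson processes
    (YP YM : ℝ≥0 → Ω → ℕ)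
    (hYP : IsStandardPoissonProcess YP P) (hYM : IsStandardPoissonProcess YM P)
    (hY : IndepFun (fun ω t => YP t ω) (fun ω t => YM t ω) P)
    -- the logarithmic price processes
    (S : ℕ → ℝ → Ω → ℝ)
    (hS : ∀ᵐ ω ∂P, ∀ N, 1 ≤ N →
      IsLogPricePath lamP lamM (fun a t => moodProcess (ξ a) (T a) t ω)
        (fun t => YP t ω) (fun t => YM t ω) N (fun t => S N t ω)) :
    ∃ s : ℝ → ℝ,
      IsFluidSolution
        (averageNetRate lamP lamM (stationaryDistribution (moodProcess (ξ 0) (T 0)) P)) s ∧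
      (∀ s' : ℝ → ℝ, IsFluidSolution
        (averageNetRate lamP lamM (stationaryDistribution (moodProcess (ξ 0) (T 0)) P)) s' →
        EqOn s' s (Ici 0)) ∧
      ∀ᵐ ω ∂P, ∀ t₀ : ℝ, 0 ≤ t₀ →
        TendstoUniformlyOn (fun N t => S N t ω) s atTop (Icc 0 t₀) := by
  set ν := stationaryDistribution (moodProcess (ξ 0) (T 0)) P with hν
  have hmono : ∀ᵐ ω ∂P, ∀ a n, T a n ω ≤ T a (n + 1) ω :=
    ae_all_iff.2 fun a => (hrenewal a).time_mono
  have hmem : ∀ᵐ ω ∂P, ∀ a n, ξ a n ω ∈ E := ae_all_iff.2 fun a => (hrenewal a).state_mem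
  have hX0 : AEMeasurable (moodProcess (ξ 0) (T 0) 0) P :=
    (measurable_pi_apply (0 : ℝ≥0)).comp_aemeasurable (hident 0).aemeasurable_fst
  have : IsProbabilityMeasure ν := Measure.isProbabilityMeasure_map hX0
  have hνE : ∀ᵐ y ∂ν, y ∈ E := by
    refine (ae_map_iff hX0 E.measurableSet).2 ?_
    filter_upwards [hmono, hmem] with ω h1 h2 using moodProcess_mem hE (h1 0) (h2 0) 0
  have hv : averageNetRate lamP lamM ν =
      fun r => ∑ j ∈ E, ν.real {j} * lamP j r - ∑ j ∈ E, ν.real {j} * lamM j r := by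
    funext r
    rw [averageNetRate, averageRate_eq_sum hνE, averageRate_eq_sum hνE]
  obtain ⟨L, M, hL, hM⟩ := exists_lipschitzWith_netRate hlamP hlamM fun j => ν.real {j}
  rw [hv]
  obtain ⟨s, hs⟩ := exists_isFluidSolution hL hM
  refine ⟨s, hs, fun s' hs' => hs.eqOn hL hs', ?_⟩
  -- The horizon `b` is introduced after `ω`, so one almost sure event serves all horizons.
  filter_upwards [hmono, hmem, hS, hYP.tendsto_div, hYM.tendsto_div, hYP.monotone, hYM.monotone,
    ae_ae_tendsto_moodFrequency (fun a => (hrenewal a).measurable_state)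
      (fun a => (hrenewal a).measurable_time) hmono (hstat 0) hident hindep E]
    with ω h1 h2 h3 h4 h5 h6 h7 h8 b hb
  exact tendstoUniformlyOn_of_isLogPricePath hlamP hlamM
    (fun a => measurable_moodProcess_path (h1 a))
    (fun a t => moodProcess_mem hE (h1 a) (h2 a) t) h8 h6 h7 h4 h5 h3 hs hb
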